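/- Let $X$ be a (real or complex) Hilbert space and let $A:D(A)\subset X\to X$ be the infinitesimal generator of an analytic $C_0$-semigroup $\{S(t);t\ge 0\}$ on $X$ (if $X$ is real, analyticity means that the complexified semigroup extends to an analytic semigroup on a sector). Endow $D(A)$ with the graph norm $\|x\|_{D(A)}=\|x\|_X+\|Ax\|_X$. Let $T>0$, let $E\subset(0,T)$ be a Lebesgue measurable set of positive measure, and let $d,k>0$ and $b\in\mathbb R$. Then there is a constant $C>0$, depending only on $E,T,d,k,b$ and on the semigroup $S$ (that is, on $X$ and $A$), with the following property. Let $U$ be a Hilbert space over the same field and let $B\in\mathcal L(D(A),U)$ with $\|B\|_{\mathcal L(D(A),U)}\le b$ be such that (a) $B$ is an admissible observation operator for $S$: for each $\tau>0$ there is $C(\tau)>0$ with $$\int_0^\tau\|BS(t)u_0\|_U^2\,dt\le C(\tau)\|u_0\|_X^2\quad\text{for all }u_0\in D(A);$$ (b) for every $L\in(0,1]$, $$\|S(L)u_0\|_X^2\le e^{d/L^k}\int_0^L\|BS(t)u_0\|_U^2\,dt\quad\text{for all }u_0\in D(A).$$ Then $$\|S(T)u_0\|_X\le C\int_E\|BS(t)u_0\|_U\,dt\quad\text{for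 all }u_0\in D(A).$$ -/

import Mathlib

open Set Filter Topology MeasureTheory

universe u v w

/-- `S`, restricted to times `t ≥ 0`, is a `C₀` (strongly continuous) semigroup of bounded linear
operators on `X`. Values of `S` at negative times are irrelevant. -/
structure IsC0Semigroup {𝕜 : Type v} [RCLike 𝕜] {X : Type u} [NormedAddCommGroup X]
    [InnerProductSpace 𝕜 X] (S : ℝ → X →L[𝕜] X) : Prop where
  map_zero : S 0 = ContinuousLinearMap.id 𝕜 X
  map_add : ∀ s t : ℝ, 0 ≤ s → 0 ≤ t → S (s + t) = (S s).comp (S t)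
  tendsto_zero : ∀ x : X, Tendsto (fun t : ℝ => S t x) (𝓝[>] 0) (𝓝 x)

/-- The (in general unbounded) operator `A`, with domain `D(A) = A.domain`, is the infinitesimal
generator of `S`: one has `x ∈ D(A)` and `A x = y` if and only if
`(S(h) x - x) / h` tends to `y` as `h → 0+`. -/
def IsInfinitesimalGenerator {𝕜 : Type v} [RCLike 𝕜] {X : Type u} [NormedAddCommGroup X]
    [InnerProductSpace 𝕜 X] (A : X →ₗ.[𝕜] X) (S : ℝ → X →L[𝕜] X) : Prop :=
  ∀ x y : X, (x, y) ∈ A.graph ↔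
    Tendsto (fun h : ℝ => ((h⁻¹ : ℝ) : 𝕜) • (S h x - x)) (𝓝[>] 0) (𝓝 y)

/-- The open sector `{z ≠ 0 : |arg z| < θ}`. -/
def openSector (θ : ℝ) : Set ℂ := {z : ℂ | z ≠ 0 ∧ |z.arg| < θ}

/-- `T` is an analytic semigroup of bounded operators on the open sector of half-angle `θ`
in the complex Hilbert space `Y`: it is holomorphic there for the operator norm, satisfies the
semigroup law, and tends strongly to the identity at the vertex of the sector. -/
structure IsSectorSemigroup {Y : Type u} [NormedAddCommGroup Y] [InnerProductSpace ℂ Y]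
    (θ : ℝ) (T : ℂ → Y →L[ℂ] Y) : Prop where
  pos : 0 < θ
  le_pi_div_two : θ ≤ Real.pi / 2
  differentiableOn : DifferentiableOn ℂ T (openSector θ)
  map_add : ∀ z ∈ openSector θ, ∀ z' ∈ openSector θ, T (z + z') = (T z).comp (T z')
  tendsto_zero : ∀ y : Y, Tendsto (fun z : ℂ => T z y) (𝓝[openSector θ] 0) (𝓝 y)

/-- The scalar of `𝕜` (which is `ℝ` or `ℂ`) as a complex number. -/
noncomputable def scalarToComplex {𝕜 : Type v} [RCLike 𝕜] (c : 𝕜) : ℂ :=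
  (RCLike.re c : ℂ) + (RCLike.im c : ℂ) * Complex.I

/-- `j : X → Y` exhibits the complex Hilbert space `Y` as the complexification of the Hilbert
space `X` over `𝕜`: it is `𝕜`-linear, preserves inner products, and `Y = j(X) + i j(X)`.
For `𝕜 = ℝ` these properties say that `(a, b) ↦ j a + i j b` identifies the usual
complexification `X ⊕ i X`, with `‖a + i b‖² = ‖a‖² + ‖b‖²`, with `Y`. For `𝕜 = ℂ` they say that
`j` is a unitary isomorphism from `X` onto `Y`, so that `Y` is just `X`. -/
structure IsComplexification (𝕜 : Type v) [RCLike 𝕜] {X Y : Type u} [NormedAddCommGroup X]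
    [InnerProductSpace 𝕜 X] [NormedAddCommGroup Y] [InnerProductSpace ℂ Y]
    (j : X →+ Y) : Prop where
  map_smul : ∀ (c : 𝕜) (x : X), j (c • x) = scalarToComplex c • j x
  inner_map : ∀ x x' : X, inner ℂ (j x) (j x') = scalarToComplex (inner 𝕜 x x')
  span : ∀ y : Y, ∃ a b : X, y = j a + Complex.I • j b

/-- The semigroup `S` on the real or complex Hilbert space `X` is analytic: it (for `𝕜 = ℝ`, its
complexification) extends to an analytic semigroup on some open sector around `(0, ∞)`. -/
def IsAnalyticSemigroup {𝕜 : Type v} [RCLike 𝕜] {X : Type u} [NormedAddCommGroup X]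
    [InnerProductSpace 𝕜 X] (S : ℝ → X →L[𝕜] X) : Prop :=
  ∃ (Y : Type u) (_ : NormedAddCommGroup Y) (_ : InnerProductSpace ℂ Y) (_ : CompleteSpace Y)
    (j : X →+ Y) (θ : ℝ) (T : ℂ → Y →L[ℂ] Y),
    IsComplexification 𝕜 j ∧ IsSectorSemigroup θ T ∧
      ∀ t : ℝ, 0 < t → ∀ x : X, T (t : ℂ) (j x) = j (S t x)

/-- For a complex Hilbert space the definition is the usual one. -/
theorem isAnalyticSemigroup_complex {X : Type u} [NormedAddCommGroup X]
    [InnerProductSpace ℂ X] [CompleteSpace X] {S : ℝ → X →L[ℂ] X} {θ : ℝ} {T : ℂ → X →L[ℂ] X}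
    (hT : IsSectorSemigroup θ T) (hTS : ∀ t : ℝ, 0 < t → T (t : ℂ) = S t) :
    IsAnalyticSemigroup S := by
  refine ⟨X, inferInstance, inferInstance, inferInstance, AddMonoidHom.id X, θ, T,
    ⟨?_, ?_, ?_⟩, hT, fun t ht x => by simp [hTS t ht]⟩
  · intro c x
    simp [scalarToComplex, Complex.re_add_im]
  · intro x x'
    simp [scalarToComplex, Complex.re_add_im]
  · intro y
    exact ⟨y, 0, by simp⟩

/-- The graph norm of `D(A)`. -/
noncomputable def graphNorm {𝕜 : Type v} [RCLike 𝕜] {X : Type u} [NormedAddCommGroup X]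
    [InnerProductSpace 𝕜 X] (A : X →ₗ.[𝕜] X) (x : A.domain) : ℝ :=
  ‖(x : X)‖ + ‖A x‖

/-- `B ∈ L(D(A), U)` with `‖B‖_{L(D(A), U)} ≤ b`, where `D(A)` carries the graph norm. -/
def ObservationBoundedBy {𝕜 : Type v} [RCLike 𝕜] {X : Type u} [NormedAddCommGroup X]
    [InnerProductSpace 𝕜 X] {U : Type w} [NormedAddCommGroup U] [InnerProductSpace 𝕜 U]
    {A : X →ₗ.[𝕜] X} (B : A.domain →ₗ[𝕜] U) (b : ℝ) : Prop :=
  ∀ x : A.domain, ‖B x‖ ≤ b * graphNorm A x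

/-- A `C₀` semigroup leaves the domain of its generator invariant. -/
theorem IsC0Semigroup.map_mem_domain {𝕜 : Type v} [RCLike 𝕜] {X : Type u}
    [NormedAddCommGroup X] [InnerProductSpace 𝕜 X] {S : ℝ → X →L[𝕜] X} {A : X →ₗ.[𝕜] X}
    (hS : IsC0Semigroup S) (hA : IsInfinitesimalGenerator A S) {t : ℝ} (ht : 0 ≤ t)
    (x : A.domain) : S t x ∈ A.domain := by
  have h1 := (hA x (A x)).1 (A.mem_graph x)
  have h2 : Tendsto (fun h : ℝ => ((h⁻¹ : ℝ) : 𝕜) • (S h (S t x) - S t x)) (𝓝[>] 0)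
      (𝓝 (S t (A x))) := by
    refine (((S t).continuous.tendsto (A x)).comp h1).congr' ?_
    filter_upwards [self_mem_nhdsWithin] with h hh
    have e : S h (S t x) = S t (S h x) := by
      have e1 := hS.map_add h t (le_of_lt hh) ht
      have e2 := hS.map_add t h ht (le_of_lt hh)
      rw [add_comm, e2] at e1
      simpa using (DFunLike.congr_fun e1 (x : X)).symm
    simp [e, map_sub]
  exact A.mem_domain_of_mem_graph ((hA _ _).2 h2)

open Classical in
/-- The observation `t ↦ B S(t) u₀ ∈ U`. It is set to `0` where `S(t) u₀ ∉ D(A)`, which does not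
happen for `t ≥ 0` and `u₀ ∈ D(A)`, by `IsC0Semigroup.map_mem_domain`. -/
noncomputable def observe {𝕜 : Type v} [RCLike 𝕜] {X : Type u} [NormedAddCommGroup X]
    [InnerProductSpace 𝕜 X] {U : Type w} [NormedAddCommGroup U] [InnerProductSpace 𝕜 U]
    {A : X →ₗ.[𝕜] X} (S : ℝ → X →L[𝕜] X) (B : A.domain →ₗ[𝕜] U) (u₀ : A.domain) (t : ℝ) : U :=
  if h : S t u₀ ∈ A.domain then B ⟨S t u₀, h⟩ else 0

/-- `B` is an admissible observation operator for `S`: for each `τ > 0` there is `C(τ) > 0` with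
`∫₀^τ ‖B S(t) u₀‖² dt ≤ C(τ) ‖u₀‖²` for all `u₀ ∈ D(A)`. (For `u₀ ∈ D(A)` the integrand is
continuous on `[0, τ]`.) -/
def IsAdmissibleObservation {𝕜 : Type v} [RCLike 𝕜] {X : Type u} [NormedAddCommGroup X]
    [InnerProductSpace 𝕜 X] {U : Type w} [NormedAddCommGroup U] [InnerProductSpace 𝕜 U]
    {A : X →ₗ.[𝕜] X} (S : ℝ → X →L[𝕜] X) (B : A.domain →ₗ[𝕜] U) : Prop :=
  ∀ τ : ℝ, 0 < τ → ∃ C : ℝ, 0 < C ∧ ∀ u₀ : A.domain,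
    ∫ t in (0 : ℝ)..τ, ‖observe S B u₀ t‖ ^ 2 ≤ C * ‖(u₀ : X)‖ ^ 2

/-- The observability inequality from time intervals with constants `d` and `k`. -/
def IntervalObservability {𝕜 : Type v} [RCLike 𝕜] {X : Type u} [NormedAddCommGroup X]
    [InnerProductSpace 𝕜 X] {U : Type w} [NormedAddCommGroup U] [InnerProductSpace 𝕜 U]
    {A : X →ₗ.[𝕜] X} (S : ℝ → X →L[𝕜] X) (B : A.domain →ₗ[𝕜] U) (d k : ℝ) : Prop :=
  ∀ L : ℝ, 0 < L → L ≤ 1 → ∀ u₀ : A.domain,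
    ‖S L u₀‖ ^ 2 ≤ Real.exp (d / L ^ k) * ∫ t in (0 : ℝ)..L, ‖observe S B u₀ t‖ ^ 2

/-! The proof turns observability from intervals into a recursive estimate on short intervals, with
observation only on a set of times, and telescopes it towards a density point of the time set.

Short intervals. By analyticity the states on `[a, a + L]` extend holomorphically to discs of radius
comparable to `L` about `a + L`. If a set fills half of a final window of length `κ L`, Chebyshev
gives a subset of measure at least a quarter of the window on which the observation is at most four
times its mean. Lagrange interpolation of degree `n` at nodes in that subset has weights of absolute
sum at most `e K ^ n`, `K = 8 e`, and is exact on polynomials up to degree `n`. Taylor expansion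
bounds the error geometrically, and `κ` is so small that the error beats `K ^ n` and leaves `exp
(-n)` times the earlier state (`norm_observe_le_of_half_interval`). The interpolation is done on
states and `B` is applied afterwards, behind one smoothing factor `S (L / 2)`, so `B` enters only
through `b`.

Recursion. Observability on the window costs `exp (d / (κ L) ^ k)`. Taking `n` a large multiple of
`1 / L ^ k` makes the error term absorb this cost, which gives `‖S (a + L) u₀‖ ≤ exp (β / L ^ k) ∫ +
exp (-1 / L ^ k) ‖S a u₀‖` (`exists_recursive_observability`).

Telescoping. Near a density point `p` the set fills half of the window of each interval `[p + r q ^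
(m + 1), p + r q ^ m]` for `r` small. With `q ^ k = β / (β + 1)` the gain at step `m` is exactly the
ratio of consecutive weights, so the weighted inequalities add up; the remainder tends to zero
because `S` is bounded near time zero. -/

/-! ### Interpolation at nodes taken from a set of positive measure -/

/-- A set of reals of measure more than `n s` contains `n + 1` points with consecutive gaps at
least `s`. -/
theorem exists_separated_points {s : ℝ} (hs : 0 < s) (n : ℕ) {G : Set ℝ} (hG : BddBelow G)
    (hvol : ENNReal.ofReal (n * s) < volume G) :
    ∃ t : ℕ → ℝ, (∀ i ≤ n, t i ∈ G) ∧ ∀ i < n, t i + s ≤ t (i + 1) := by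
  induction n generalizing G with
  | zero =>
    have hne : G.Nonempty := nonempty_of_measure_ne_zero (μ := volume) (by
      intro h; simp [h] at hvol)
    obtain ⟨x, hx⟩ := hne
    exact ⟨fun _ => x, fun i _ => hx, fun i hi => absurd hi (Nat.not_lt_zero i)⟩
  | succ n ih =>
    have hne : G.Nonempty := nonempty_of_measure_ne_zero (μ := volume) (by
      intro h; simp [h] at hvol)
    obtain ⟨r, hr, hrv⟩ : ∃ r : ℝ, (n + 1) * s < r ∧ ENNReal.ofReal r ≤ volume G := by
      obtain ⟨r, hr0, hr1, hr2⟩ := ENNReal.lt_iff_exists_real_btwn.1 hvol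
      refine ⟨r, ?_, hr2.le⟩
      have := (ENNReal.ofReal_lt_ofReal_iff_of_nonneg (by positivity)).1 hr1
      push_cast at this
      exact this
    obtain ⟨η, hη, hηr⟩ : ∃ η : ℝ, 0 < η ∧ (n + 1) * s + 2 * η < r :=
      ⟨(r - (n + 1) * s) / 4, by linarith, by linarith⟩
    -- Greedy choice: take a point within `η` of the infimum and discard an interval of length `s +
    -- η`; the slack `2 η` keeps the remaining measure above `n s`.
    set α := sInf G
    obtain ⟨x, hxG, hx⟩ : ∃ x ∈ G, x < α + η := exists_lt_of_csInf_lt hne (by simp only [α]; linarith)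
    have hsub : G ⊆ Icc α (α + s + η) ∪ (G ∩ Ici (x + s)) := by
      intro y hy
      by_cases h : y ≤ α + s + η
      · exact Or.inl ⟨csInf_le hG hy, h⟩
      · exact Or.inr ⟨hy, by simp only [mem_Ici]; linarith⟩
    have hG' : ENNReal.ofReal (n * s) < volume (G ∩ Ici (x + s)) := by
      by_contra hcon
      have h1 : volume G ≤ ENNReal.ofReal (s + η) + ENNReal.ofReal (n * s) := by
        refine (measure_mono hsub).trans ((measure_union_le _ _).trans ?_)
        refine add_le_add ?_ (not_lt.1 hcon)
        rw [Real.volume_Icc]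
        exact ENNReal.ofReal_le_ofReal (by linarith)
      rw [← ENNReal.ofReal_add (by positivity) (by positivity)] at h1
      have h2 := hrv.trans h1
      rw [ENNReal.ofReal_le_ofReal_iff (by positivity)] at h2
      nlinarith
    obtain ⟨t, ht, hts⟩ := ih (hG.mono inter_subset_left) hG'
    refine ⟨fun i => Nat.casesOn i x t, ?_, ?_⟩
    · rintro (_ | i) hi
      · exact hxG
      · exact (ht i (by omega)).1
    · rintro (_ | i) hi
      · exact (ht 0 (by omega)).2
      · exact hts i (by omega)

theorem mul_sub_le_sub_of_gaps {s : ℝ} {n : ℕ} {t : ℕ → ℝ} (h : ∀ i < n, t i + s ≤ t (i + 1))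
    {i j : ℕ} (hij : i ≤ j) (hj : j ≤ n) : s * ((j : ℝ) - i) ≤ t j - t i := by
  induction j, hij using Nat.le_induction with
  | base => simp
  | succ j hij ih =>
    have h1 := ih (by omega)
    have h2 := h j (by omega)
    push_cast
    linarith

theorem mul_abs_sub_le_abs_sub_of_gaps {s : ℝ} {n : ℕ} {t : ℕ → ℝ}
    (h : ∀ i < n, t i + s ≤ t (i + 1)) {i j : ℕ} (hi : i ≤ n) (hj : j ≤ n) :
    s * |(i : ℝ) - j| ≤ |t i - t j| := by
  rcases le_total i j with hij | hij
  · have h1 := mul_sub_le_sub_of_gaps h hij hj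
    have h2 : (i : ℝ) ≤ j := by exact_mod_cast hij
    rw [abs_sub_comm, abs_of_nonneg (sub_nonneg.2 h2), abs_sub_comm]
    exact h1.trans (le_abs_self _)
  · have h1 := mul_sub_le_sub_of_gaps h hij hi
    have h2 : (j : ℝ) ≤ i := by exact_mod_cast hij
    rw [abs_of_nonneg (sub_nonneg.2 h2)]
    exact h1.trans (le_abs_self _)

/-- These are the Lagrange denominators for the nodes `0, …, n`; dividing `n!` by them produces
binomial coefficients, which sum to `2 ^ n`. -/
theorem prod_erase_abs_sub_eq_factorial {n i : ℕ} (hi : i ≤ n) :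
    ∏ j ∈ (Finset.range (n + 1)).erase i, |(i : ℝ) - j| = i.factorial * (n - i).factorial := by
  induction n, hi using Nat.le_induction with
  | base =>
    rw [Finset.range_add_one, Finset.erase_insert (by simp)]
    rw [← Finset.prod_range_reflect, ← Finset.prod_range_add_one_eq_factorial]
    simp only [Nat.sub_self, Nat.factorial_zero, Nat.cast_one, mul_one, Nat.cast_prod]
    refine Finset.prod_congr rfl fun j hj => ?_
    have : j < i := Finset.mem_range.1 hj
    have e : ((i - 1 - j : ℕ) : ℝ) = i - 1 - j := by
      rw [Nat.cast_sub (by omega), Nat.cast_sub (by omega)]; simp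
    rw [e]
    push_cast
    rw [abs_of_nonneg] <;> [ring; skip]
    have : (0 : ℝ) ≤ j := Nat.cast_nonneg j
    linarith
  | succ n hin ih =>
    rw [Finset.range_add_one, Finset.erase_insert_of_ne (by omega), Finset.prod_insert (by simp), ih,
      Nat.sub_add_comm hin, Nat.factorial_succ]
    have h2 : (i : ℝ) ≤ n := by exact_mod_cast hin
    rw [abs_sub_comm, abs_of_nonneg (by push_cast; linarith)]
    push_cast [Nat.cast_sub hin]
    ring

/-- Interpolation nodes in a set `G` that fills a quarter of an interval, with weights whose
absolute sum grows at most geometrically with the degree. -/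
theorem exists_interpolation_nodes {G : Set ℝ} {α l x : ℝ} (hl : 0 < l)
    (hG : G ⊆ Icc α (α + l)) (hvol : ENNReal.ofReal (l / 4) ≤ volume G)
    (hx : x ∈ Icc α (α + l)) (n : ℕ) :
    ∃ t c : ℕ → ℝ, (∀ i ∈ Finset.range (n + 1), t i ∈ G) ∧
      ∑ i ∈ Finset.range (n + 1), |c i| ≤ Real.exp 1 * (8 * Real.exp 1) ^ n ∧
      ∀ (y : ℝ) (m : ℕ), m ≤ n →
        ∑ i ∈ Finset.range (n + 1), c i * (t i - y) ^ m = (x - y) ^ m := by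
  -- The denominator `n + 1`, rather than `n`, makes `n s < l / 4` strict and covers `n = 0`.
  set s : ℝ := l / (4 * (n + 1)) with hs
  have hs0 : 0 < s := by positivity
  have hns : (n : ℝ) * s < l / 4 := by
    rw [hs, mul_div_assoc', div_lt_div_iff₀ (by positivity) (by positivity)]
    nlinarith
  obtain ⟨t, htG, hgap⟩ := exists_separated_points hs0 n (BddBelow.mono hG bddBelow_Icc)
    (((ENNReal.ofReal_lt_ofReal_iff (by positivity)).2 hns).trans_le hvol)
  have hmul : ∀ i j, i ≤ n → j ≤ n → s * |(i : ℝ) - j| ≤ |t i - t j| :=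
    fun i j hi hj => mul_abs_sub_le_abs_sub_of_gaps hgap hi hj
  have hpos : ∀ i j : ℕ, i ≠ j → 0 < |(i : ℝ) - j| := fun i j h =>
    abs_pos.2 (sub_ne_zero.2 (by exact_mod_cast h))
  have hinj : Set.InjOn t (Finset.range (n + 1)) := by
    intro i hi j hj hij
    by_contra hne
    have h1 := hmul i j (by simpa [Nat.lt_succ_iff] using hi) (by simpa [Nat.lt_succ_iff] using hj)
    rw [hij, sub_self, abs_zero] at h1
    exact absurd h1 (not_le.2 (mul_pos hs0 (hpos i j hne)))
  refine ⟨t, fun i => (Lagrange.basis (Finset.range (n + 1)) t i).eval x,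
    fun i hi => htG i (by simpa [Nat.lt_succ_iff] using hi), ?_, ?_⟩
  · have hc : ∀ i ∈ Finset.range (n + 1),
        |(Lagrange.basis (Finset.range (n + 1)) t i).eval x|
          ≤ (4 * (n + 1)) ^ n / n.factorial * n.choose i := by
      intro i hi
      have hin : i ≤ n := by simpa [Nat.lt_succ_iff] using hi
      rw [Lagrange.basis, Polynomial.eval_prod, Finset.abs_prod]
      have hle : ∀ j ∈ (Finset.range (n + 1)).erase i,
          |(Lagrange.basisDivisor (t i) (t j)).eval x| ≤ 4 * (n + 1) / |(i : ℝ) - j| := by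
        intro j hj
        have hji : j ≠ i := Finset.ne_of_mem_erase hj
        have hjn : j ≤ n := by simpa [Nat.lt_succ_iff] using Finset.mem_of_mem_erase hj
        have h1 := hmul i j hin hjn
        have h2 := hpos i j hji.symm
        have h3 : 0 < |t i - t j| := (mul_pos hs0 h2).trans_le h1
        have h4 : |x - t j| ≤ l := by
          have := hG (htG j hjn)
          rw [abs_le]; constructor <;> linarith [this.1, this.2, hx.1, hx.2]
        rw [Lagrange.basisDivisor]
        simp only [Polynomial.eval_mul, Polynomial.eval_C, Polynomial.eval_sub, Polynomial.eval_X]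
        rw [abs_mul, abs_inv, inv_mul_eq_div]
        calc |x - t j| / |t i - t j| ≤ l / (s * |(i : ℝ) - j|) := by gcongr
          _ = 4 * (n + 1) / |(i : ℝ) - j| := by rw [hs]; field_simp
      refine (Finset.prod_le_prod (fun _ _ => abs_nonneg _) hle).trans_eq ?_
      rw [Finset.prod_div_distrib, prod_erase_abs_sub_eq_factorial hin, Finset.prod_const,
        Finset.card_erase_of_mem hi, Finset.card_range, Nat.add_sub_cancel,
        Nat.cast_choose ℝ hin]
      have := n.factorial_ne_zero
      field_simp
    refine (Finset.sum_le_sum hc).trans ?_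
    rw [← Finset.mul_sum]
    have hch : ∑ i ∈ Finset.range (n + 1), (n.choose i : ℝ) = 2 ^ n := by
      exact_mod_cast Nat.sum_range_choose n
    rw [hch]
    -- The factor `(n + 1) ^ n / n!` is at most `exp (n + 1)`, so the growth of the weights is
    -- geometric.
    have h5 := Real.pow_div_factorial_le_exp (x := (n : ℝ) + 1) (by positivity) n
    calc (4 * ((n : ℝ) + 1)) ^ n / n.factorial * 2 ^ n
        = 8 ^ n * (((n : ℝ) + 1) ^ n / n.factorial) := by
          rw [mul_pow, show (8 : ℝ) = 4 * 2 by norm_num, mul_pow]; ring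
      _ ≤ 8 ^ n * Real.exp ((n : ℝ) + 1) := by gcongr
      _ = Real.exp 1 * (8 * Real.exp 1) ^ n := by
          rw [Real.exp_add, mul_pow, ← Real.exp_nat_mul, mul_one]; ring
  -- Interpolation at `n + 1` nodes reproduces `(X - y) ^ m` for `m ≤ n`. The centre `y` is left
  -- free so that it can later be the centre of a Taylor expansion.
  · intro y m hm
    have hdeg : ((Polynomial.X - Polynomial.C y) ^ m : Polynomial ℝ).degree
        < (Finset.range (n + 1)).card := by
      rw [Polynomial.degree_pow, Polynomial.degree_X_sub_C, Finset.card_range]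
      simp only [nsmul_eq_mul, mul_one]
      exact_mod_cast Nat.lt_succ_of_le hm
    have h := congrArg (Polynomial.eval x) (Lagrange.eq_interpolate hinj hdeg)
    rw [Lagrange.interpolate_apply, Polynomial.eval_finsetSum] at h
    simp only [Polynomial.eval_pow, Polynomial.eval_sub, Polynomial.eval_X, Polynomial.eval_C,
      Polynomial.eval_mul] at h
    rw [h]
    exact Finset.sum_congr rfl fun i _ => mul_comm _ _

/-- The error of an interpolation formula that is exact up to degree `n`, for a function
holomorphic on a disc much larger than the set of nodes. -/
theorem norm_sub_sum_smul_le_of_exact {Y : Type*} [NormedAddCommGroup Y] [NormedSpace ℂ Y]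
    [CompleteSpace Y] {h : ℂ → Y} {y R M ρ Λ x : ℝ} {n : ℕ} {t c : ℕ → ℝ} (hR : 0 < R)
    (hd : DiffContOnCl ℂ h (Metric.ball (y : ℂ) R))
    (hM : ∀ z ∈ Metric.sphere (y : ℂ) R, ‖h z‖ ≤ M) (hM0 : 0 ≤ M) (hρ0 : 0 ≤ ρ) (hρ : ρ ≤ 1 / 2)
    (hx : |x - y| ≤ ρ * R) (ht : ∀ i ∈ Finset.range (n + 1), |t i - y| ≤ ρ * R)
    (hc : ∑ i ∈ Finset.range (n + 1), |c i| ≤ Λ)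
    (hex : ∀ m ≤ n, ∑ i ∈ Finset.range (n + 1), c i * (t i - y) ^ m = (x - y) ^ m) :
    ‖h x - ∑ i ∈ Finset.range (n + 1), (c i : ℂ) • h (t i)‖
      ≤ 2 * (1 + Λ) * M * ρ ^ (n + 1) := by
  set a : ℕ → Y := fun m => (m.factorial : ℂ)⁻¹ • iteratedDeriv m h y with ha
  have hΛ : 0 ≤ Λ := (Finset.sum_nonneg fun _ _ => abs_nonneg _).trans hc
  have ha_le : ∀ m, ‖a m‖ ≤ M / R ^ m := by
    intro m
    have h1 := Complex.norm_iteratedDeriv_le_of_forall_mem_sphere_norm_le m hR hd hM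
    have h2 : (0 : ℝ) < m.factorial := by exact_mod_cast m.factorial_pos
    rw [ha, norm_smul, norm_inv, Complex.norm_natCast, inv_mul_le_iff₀ h2]
    rwa [← mul_div_assoc]
  have hsum : ∀ z : ℝ, |z - y| ≤ ρ * R → HasSum (fun m => (((z - y) ^ m : ℝ) : ℂ) • a m) (h z) := by
    intro z hz
    have hz' : (z : ℂ) ∈ Metric.ball (y : ℂ) R := by
      rw [Metric.mem_ball, dist_eq_norm, ← Complex.ofReal_sub, Complex.norm_real, Real.norm_eq_abs]
      nlinarith
    convert! Complex.hasSum_taylorSeries_on_ball hd.differentiableOn hz' using 2 with m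
    rw [ha, smul_comm, Complex.ofReal_pow, Complex.ofReal_sub]
  have hE : HasSum (fun m => (((x - y) ^ m - ∑ i ∈ Finset.range (n + 1), c i * (t i - y) ^ m : ℝ) : ℂ)
      • a m) (h x - ∑ i ∈ Finset.range (n + 1), (c i : ℂ) • h (t i)) := by
    have h1 := (hsum x hx).sub (hasSum_sum fun i hi => (hsum (t i) (ht i hi)).const_smul (c i : ℂ))
    convert h1 using 2 with m
    rw [Complex.ofReal_sub, sub_smul, Complex.ofReal_sum, Finset.sum_smul]
    simp only [Complex.ofReal_mul, mul_smul]
  set e : ℕ → Y := fun m =>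
    (((x - y) ^ m - ∑ i ∈ Finset.range (n + 1), c i * (t i - y) ^ m : ℝ) : ℂ) • a m with he
  have he0 : ∀ m ≤ n, e m = 0 := by
    intro m hm
    simp only [he]
    rw [hex m hm, sub_self, Complex.ofReal_zero, zero_smul]
  have he_le : ∀ m, ‖e m‖ ≤ (1 + Λ) * M * ρ ^ m := by
    intro m
    have h1 : |(x - y) ^ m - ∑ i ∈ Finset.range (n + 1), c i * (t i - y) ^ m|
        ≤ (1 + Λ) * (ρ * R) ^ m := by
      refine (abs_sub _ _).trans ?_
      rw [one_add_mul]
      refine add_le_add ?_ ?_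
      · rw [abs_pow]; gcongr
      · refine (Finset.abs_sum_le_sum_abs _ _).trans ?_
        refine (Finset.sum_le_sum (g := fun i => |c i| * (ρ * R) ^ m) fun i hi => ?_).trans ?_
        · rw [abs_mul, abs_pow]
          gcongr
          exact ht i hi
        · rw [← Finset.sum_mul]; gcongr
    rw [he, norm_smul, Complex.norm_real, Real.norm_eq_abs]
    calc _ ≤ ((1 + Λ) * (ρ * R) ^ m) * (M / R ^ m) :=
          mul_le_mul h1 (ha_le m) (norm_nonneg _) (by positivity)
      _ = (1 + Λ) * M * ρ ^ m := by rw [mul_pow]; field_simp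
  -- Exactness removes the Taylor terms up to degree `n`; the tail is dominated by a geometric
  -- series of ratio `1 / 2`, whose sum is the factor `2`.
  have hshift : HasSum (fun m => e (m + (n + 1)))
      (h x - ∑ i ∈ Finset.range (n + 1), (c i : ℂ) • h (t i)) := by
    rw [hasSum_nat_add_iff]
    rw [Finset.sum_eq_zero fun i hi => he0 i (by simpa [Nat.lt_succ_iff] using hi), add_zero]
    exact hE
  have hgeo : HasSum (fun m : ℕ => (1 + Λ) * M * ρ ^ (n + 1) * (1 / 2) ^ m)
      ((1 + Λ) * M * ρ ^ (n + 1) * 2) := hasSum_geometric_two.mul_left _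
  have := hshift.norm_le_of_bounded hgeo fun m => by
    refine (he_le _).trans ?_
    rw [pow_add, mul_comm (ρ ^ m), ← mul_assoc]
    gcongr
  linarith

/-! ### Bounds from analyticity, transferred through the complexification -/

theorem scalarToComplex_ofReal {𝕜 : Type v} [RCLike 𝕜] (r : ℝ) :
    scalarToComplex ((r : ℝ) : 𝕜) = (r : ℂ) := by
  simp [scalarToComplex]

theorem IsComplexification.norm_map {𝕜 : Type v} [RCLike 𝕜] {X Y : Type u} [NormedAddCommGroup X]
    [InnerProductSpace 𝕜 X] [NormedAddCommGroup Y] [InnerProductSpace ℂ Y] {j : X →+ Y}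
    (hj : IsComplexification 𝕜 j) (x : X) : ‖j x‖ = ‖x‖ := by
  have h := hj.inner_map x x
  rw [inner_self_eq_norm_sq_to_K, inner_self_eq_norm_sq_to_K] at h
  have h2 : scalarToComplex (((‖x‖ : ℝ) : 𝕜) ^ 2) = ((‖x‖ ^ 2 : ℝ) : ℂ) := by
    rw [← scalarToComplex_ofReal (𝕜 := 𝕜)]
    push_cast
    rfl
  rw [h2] at h
  have h3 : ‖j x‖ ^ 2 = ‖x‖ ^ 2 := by
    apply Complex.ofReal_injective
    rw [← h]
    push_cast
    rfl
  exact (sq_eq_sq₀ (norm_nonneg _) (norm_nonneg _)).1 h3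

theorem IsComplexification.map_real_smul {𝕜 : Type v} [RCLike 𝕜] {X Y : Type u}
    [NormedAddCommGroup X] [InnerProductSpace 𝕜 X] [NormedAddCommGroup Y] [InnerProductSpace ℂ Y]
    {j : X →+ Y} (hj : IsComplexification 𝕜 j) (r : ℝ) (x : X) :
    j ((r : 𝕜) • x) = (r : ℂ) • j x := by
  rw [hj.map_smul, scalarToComplex_ofReal]

/-- A sector contains the discs `|z - x| < c x` for all `x > 0`. -/
theorem exists_ball_subset_openSector {θ : ℝ} (hθ : 0 < θ) :
    ∃ c : ℝ, 0 < c ∧ c < 1 ∧ ∀ x : ℝ, 0 < x → Metric.ball (x : ℂ) (c * x) ⊆ openSector θ := by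
  -- The sector is invariant under positive dilations, so a disc about `1` suffices.
  have h1 : ∀ᶠ z : ℂ in 𝓝 1, z ≠ 0 ∧ |z.arg| < θ := by
    refine (eventually_ne_nhds one_ne_zero).and ?_
    have : ContinuousAt (fun z : ℂ => |z.arg|) 1 :=
      (Complex.continuousAt_arg (by simp)).abs
    exact this.eventually_lt continuousAt_const (by simpa using hθ)
  obtain ⟨c, hc, hball⟩ := Metric.eventually_nhds_iff_ball.1 h1
  refine ⟨min c (1 / 2), lt_min hc (by norm_num), (min_le_right _ _).trans_lt (by norm_num), ?_⟩
  intro x hx z hz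
  have hx' : (x : ℂ) ≠ 0 := by exact_mod_cast hx.ne'
  have hz1 : z / x ∈ Metric.ball (1 : ℂ) c := by
    rw [Metric.mem_ball, dist_eq_norm] at hz ⊢
    have : z / x - 1 = (z - x) / x := by field_simp
    rw [this, norm_div, Complex.norm_real, Real.norm_eq_abs, abs_of_pos hx, div_lt_iff₀ hx]
    exact hz.trans_le (mul_le_mul_of_nonneg_right (min_le_left _ _) hx.le)
  have h2 := hball _ hz1
  have h3 : z = (x : ℂ) * (z / x) := by field_simp
  rw [openSector, mem_ofPred_eq, h3, Complex.arg_real_mul _ hx]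
  exact ⟨mul_ne_zero hx' h2.1, h2.2⟩

/-- By the uniform boundedness principle, an analytic semigroup is bounded near the vertex. -/
theorem IsSectorSemigroup.exists_norm_le {Y : Type u} [NormedAddCommGroup Y]
    [InnerProductSpace ℂ Y] [CompleteSpace Y] {θ : ℝ} {T : ℂ → Y →L[ℂ] Y}
    (hT : IsSectorSemigroup θ T) :
    ∃ δ M : ℝ, 0 < δ ∧ 0 < M ∧ ∀ z ∈ openSector θ, ‖z‖ < δ → ‖T z‖ ≤ M := by
  by_contra! hcon
  have h1 : ∀ n : ℕ, ∃ z ∈ openSector θ, ‖z‖ < 1 / ((n : ℝ) + 1) ∧ (n : ℝ) + 1 < ‖T z‖ :=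
    fun n => hcon _ _ (by positivity) (by positivity)
  choose z hz hz0 hzT using h1
  have hlim : Tendsto z atTop (𝓝[openSector θ] 0) := by
    refine tendsto_nhdsWithin_iff.2 ⟨?_, Eventually.of_forall hz⟩
    exact squeeze_zero_norm (fun n => (hz0 n).le) tendsto_one_div_add_atTop_nhds_zero_nat
  obtain ⟨C, hC⟩ := banach_steinhaus (g := fun n => T (z n)) fun y => by
    obtain ⟨C, hC⟩ := ((hT.tendsto_zero y).comp hlim).norm.bddAbove_range
    exact ⟨C, fun n => hC ⟨n, rfl⟩⟩
  obtain ⟨n, hn⟩ := exists_nat_gt C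
  linarith [hC n, hzT n]

/-- The consequences of analyticity used below, stated on the original space. -/
structure AnalyticBounds {𝕜 : Type v} [RCLike 𝕜] {X : Type u} [NormedAddCommGroup X]
    [InnerProductSpace 𝕜 X] (S : ℝ → X →L[𝕜] X) (A : X →ₗ.[𝕜] X) (c δ M : ℝ) : Prop where
  continuousOn : ∀ x : X, ContinuousOn (fun t => S t x) (Ioi 0)
  norm_le : ∀ t : ℝ, 0 < t → t < δ → ∀ x : X, ‖S t x‖ ≤ M * ‖x‖
  norm_generator_le : ∀ t : ℝ, 0 < t → t < δ → ∀ x y : X, (S t x, y) ∈ A.graph →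
    ‖y‖ ≤ M / t * ‖x‖
  norm_interpolation_le : ∀ (τ : ℝ), 0 < τ → τ < δ → ∀ (v : X) (n : ℕ) (t w : ℕ → ℝ) (x ρ Λ : ℝ),
    0 ≤ ρ → ρ ≤ 1 / 2 → |x - τ| ≤ ρ * (c * τ) →
    (∀ i ∈ Finset.range (n + 1), |t i - τ| ≤ ρ * (c * τ)) →
    ∑ i ∈ Finset.range (n + 1), |w i| ≤ Λ →
    (∀ m ≤ n, ∑ i ∈ Finset.range (n + 1), w i * (t i - τ) ^ m = (x - τ) ^ m) →
    ‖S x v - ∑ i ∈ Finset.range (n + 1), ((w i : ℝ) : 𝕜) • S (t i) v‖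
      ≤ 2 * (1 + Λ) * (M * ‖v‖) * ρ ^ (n + 1)

/-- All bounds are Cauchy estimates on discs `|z - τ| ≤ c τ` inside the sector, where the extension
is uniformly bounded for small `τ`. They descend to `X` because `j` is a real-linear isometry and
the interpolation weights are real. -/
theorem IsC0Semigroup.exists_analyticBounds {𝕜 : Type v} [RCLike 𝕜] {X : Type u}
    [NormedAddCommGroup X] [InnerProductSpace 𝕜 X] {S : ℝ → X →L[𝕜] X} {A : X →ₗ.[𝕜] X}
    (hS : IsC0Semigroup S) (hA : IsInfinitesimalGenerator A S) (hSa : IsAnalyticSemigroup S) :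
    ∃ c δ M : ℝ, 0 < c ∧ c < 1 ∧ 0 < δ ∧ 0 < M ∧ AnalyticBounds S A c δ M := by
  obtain ⟨Y, _, _, _, j, θ, T, hj, hT, hTS⟩ := hSa
  obtain ⟨c₀, hc₀, hc₀1, hball⟩ := exists_ball_subset_openSector hT.pos
  obtain ⟨δ₀, M₀, hδ₀, hM₀, hbd⟩ := hT.exists_norm_le
  set c := c₀ / 2 with hc
  have hcpos : 0 < c := by positivity
  have hclosed : ∀ τ : ℝ, 0 < τ → Metric.closedBall (τ : ℂ) (c * τ) ⊆ openSector θ :=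
    fun τ hτ => (Metric.closedBall_subset_ball (by rw [hc]; nlinarith)).trans (hball τ hτ)
  -- Points of the disc have modulus at most `(1 + c) τ < 2 τ`, hence the threshold `δ₀ / 2`.
  have hbound : ∀ τ : ℝ, 0 < τ → τ < δ₀ / 2 → ∀ y : Y, ∀ z ∈ Metric.closedBall (τ : ℂ) (c * τ),
      ‖T z y‖ ≤ M₀ * ‖y‖ := by
    intro τ hτ hτδ y z hz
    refine (T z).le_of_opNorm_le (hbd z (hclosed τ hτ hz) ?_) y
    have h1 := norm_le_norm_add_norm_sub' z (τ : ℂ)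
    rw [Metric.mem_closedBall, dist_eq_norm] at hz
    rw [Complex.norm_real, Real.norm_eq_abs, abs_of_pos hτ] at h1
    nlinarith
  have hdiff : ∀ τ : ℝ, 0 < τ → ∀ y : Y,
      DiffContOnCl ℂ (fun z => T z y) (Metric.ball (τ : ℂ) (c * τ)) := by
    intro τ hτ y
    refine DifferentiableOn.diffContOnCl ?_
    rw [closure_ball _ (by positivity)]
    exact (hT.differentiableOn.clm_apply (differentiableOn_const y)).mono (hclosed τ hτ)
  have hdiffAt : ∀ τ : ℝ, 0 < τ → ∀ y : Y, DifferentiableAt ℂ (fun z => T z y) τ := by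
    intro τ hτ y
    exact (hdiff τ hτ y).differentiableAt Metric.isOpen_ball (Metric.mem_ball_self (by positivity))
  have hiso : Isometry j := AddMonoidHomClass.isometry_of_norm j hj.norm_map
  refine ⟨c, δ₀ / 2, max M₀ (M₀ / c), hcpos, by linarith, by positivity,
    lt_max_of_lt_left hM₀, ?_, ?_, ?_, ?_⟩
  · intro x t ht
    refine ContinuousAt.continuousWithinAt ?_
    rw [ContinuousAt, hiso.isUniformInducing.isInducing.tendsto_nhds_iff]
    have h1 : Tendsto (fun s : ℝ => T (s : ℂ) (j x)) (𝓝 t) (𝓝 (T (t : ℂ) (j x))) :=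
      (hdiffAt t ht (j x)).continuousAt.tendsto.comp Complex.continuous_ofReal.continuousAt.tendsto
    rw [hTS t ht] at h1
    refine h1.congr' ?_
    filter_upwards [Ioi_mem_nhds ht] with s hs
    exact hTS s hs x
  · intro t ht htδ x
    rw [← hj.norm_map (S t x), ← hTS t ht, ← hj.norm_map x]
    exact (hbound t ht htδ _ _ (Metric.mem_closedBall_self (by positivity))).trans
      (mul_le_mul_of_nonneg_right (le_max_left _ _) (norm_nonneg _))
  · intro t ht htδ x y hy
    have h1 := (hA _ _).1 hy
    have h2 : Tendsto (fun h : ℝ => j (((h⁻¹ : ℝ) : 𝕜) • (S h (S t x) - S t x))) (𝓝[>] 0)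
        (𝓝 (j y)) := (hiso.continuous.tendsto y).comp h1
    have h3 : HasDerivAt (fun s : ℝ => T (s : ℂ) (j x)) (deriv (fun z => T z (j x)) t) t :=
      by
      simpa [Function.comp_def] using (hdiffAt t ht (j x)).hasDerivAt.scomp t Complex.ofRealCLM.hasDerivAt
    have h4 := h3.tendsto_slope_zero_right
    -- The right difference quotients defining the generator are those of the holomorphic orbit, so
    -- `j y` is its complex derivative at `t`; Cauchy's estimate on the circle of radius `c t` then
    -- gives `M₀ / (c t)`.
    have h5 : j y = deriv (fun z => T z (j x)) t := by
      refine tendsto_nhds_unique h2 (h4.congr' ?_)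
      filter_upwards [self_mem_nhdsWithin] with h hh
      have hh' : 0 < h := hh
      rw [hj.map_real_smul, map_sub, hTS t ht, hTS (t + h) (by positivity), add_comm t h,
        hS.map_add h t hh'.le ht.le]
      rw [Complex.coe_smul]
      rfl
    rw [← hj.norm_map y, h5]
    refine (Complex.norm_deriv_le_of_forall_mem_sphere_norm_le (by positivity) (hdiff t ht (j x))
      fun z hz => hbound t ht htδ _ z (Metric.sphere_subset_closedBall hz)).trans ?_
    rw [hj.norm_map]
    calc M₀ * ‖x‖ / (c * t) = M₀ / c / t * ‖x‖ := by field_simp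
      _ ≤ _ := by gcongr; exact le_max_right _ _
  · intro τ hτ hτδ v n t w x ρ Λ hρ0 hρ hx ht hw hex
    have hp : ∀ s : ℝ, |s - τ| ≤ ρ * (c * τ) → 0 < s := by
      intro s hs
      have h6 : ρ * (c * τ) ≤ 1 / 2 * (1 * τ) := by
        gcongr
        linarith
      have := (abs_le.1 hs).1
      linarith
    have hmain := norm_sub_sum_smul_le_of_exact (h := fun z => T z (j v)) (R := c * τ)
      (M := M₀ * ‖v‖) (by positivity) (hdiff τ hτ (j v))
      (fun z hz => by
        rw [← hj.norm_map v]
        exact hbound τ hτ hτδ _ z (Metric.sphere_subset_closedBall hz))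
      (by positivity) hρ0 hρ hx ht hw hex
    have hΛ : 0 ≤ Λ := (Finset.sum_nonneg fun _ _ => abs_nonneg _).trans hw
    rw [← hj.norm_map, map_sub, map_sum, ← hTS x (hp x hx)]
    refine (le_of_eq ?_).trans (hmain.trans ?_)
    · congr 2
      refine Finset.sum_congr rfl fun i hi => ?_
      rw [hj.map_real_smul, hTS _ (hp _ (ht i hi))]
    · gcongr
      exact le_max_left _ _

/-! ### The observation along orbits -/

theorem IsC0Semigroup.map_mem_graph {𝕜 : Type v} [RCLike 𝕜] {X : Type u}
    [NormedAddCommGroup X] [InnerProductSpace 𝕜 X] {S : ℝ → X →L[𝕜] X} {A : X →ₗ.[𝕜] X}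
    (hS : IsC0Semigroup S) (hA : IsInfinitesimalGenerator A S) {t : ℝ} (ht : 0 ≤ t)
    (x : A.domain) : (S t x, S t (A x)) ∈ A.graph := by
  refine (hA _ _).2 ((((S t).continuous.tendsto (A x)).comp ((hA x (A x)).1
    (A.mem_graph x))).congr' ?_)
  filter_upwards [self_mem_nhdsWithin] with h hh
  have e : S h (S t x) = S t (S h x) := by
    rw [← ContinuousLinearMap.comp_apply, ← ContinuousLinearMap.comp_apply,
      ← hS.map_add h t (le_of_lt hh) ht, ← hS.map_add t h ht (le_of_lt hh), add_comm]
  simp [e, map_sub]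

theorem LinearPMap.apply_eq_of_mem_graph {R E F : Type*} [Ring R] [AddCommGroup E] [Module R E]
    [AddCommGroup F] [Module R F] {f : E →ₗ.[R] F} {x : f.domain} {y : F}
    (h : ((x : E), y) ∈ f.graph) : f x = y := by
  obtain ⟨z, hz, hy⟩ := (LinearPMap.mem_graph_iff f).1 h
  rw [show x = z from Subtype.ext hz.symm]
  exact hy

section Observation

variable {𝕜 : Type v} [RCLike 𝕜] {X : Type u} [NormedAddCommGroup X] [InnerProductSpace 𝕜 X]
  {U : Type w} [NormedAddCommGroup U] [InnerProductSpace 𝕜 U] {A : X →ₗ.[𝕜] X}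
  {S : ℝ → X →L[𝕜] X} {B : A.domain →ₗ[𝕜] U} {b : ℝ}

theorem observe_eq (hS : IsC0Semigroup S) (hA : IsInfinitesimalGenerator A S) (u₀ : A.domain)
    {t : ℝ} (ht : 0 ≤ t) :
    observe S B u₀ t = B ⟨S t u₀, hS.map_mem_domain hA ht u₀⟩ :=
  dif_pos (hS.map_mem_domain hA ht u₀)

theorem observe_add (hS : IsC0Semigroup S) (hA : IsInfinitesimalGenerator A S) (u₀ : A.domain)
    {a t : ℝ} (ha : 0 ≤ a) (ht : 0 ≤ t) :
    observe S B ⟨S a u₀, hS.map_mem_domain hA ha u₀⟩ t = observe S B u₀ (a + t) := by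
  rw [observe_eq hS hA _ ht, observe_eq hS hA _ (add_nonneg ha ht)]
  congr 2
  rw [add_comm a t, hS.map_add t a ht ha]
  rfl

theorem ObservationBoundedBy.norm_le (hB : ObservationBoundedBy B b) (x : A.domain) :
    ‖B x‖ ≤ |b| * (‖(x : X)‖ + ‖A x‖) :=
  (hB x).trans (mul_le_mul_of_nonneg_right (le_abs_self b)
    (add_nonneg (norm_nonneg _) (norm_nonneg _)))

theorem continuousOn_orbit {c δ M : ℝ} (hS : IsC0Semigroup S) (H : AnalyticBounds S A c δ M)
    (x : X) : ContinuousOn (fun t => S t x) (Ici 0) := by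
  intro t ht
  rcases eq_or_lt_of_le (mem_Ici.1 ht) with rfl | ht'
  · rw [← continuousWithinAt_Ioi_iff_Ici]
    have h := hS.tendsto_zero x
    rw [ContinuousWithinAt, hS.map_zero]
    exact h
  · exact ((H.continuousOn x).continuousAt (Ioi_mem_nhds ht')).continuousWithinAt

/-- Since `A S(t) u₀ = S(t) A u₀`, the orbit is continuous for the graph norm, for which `B` is
bounded. This supplies the integrability without which the integrals would take the default value
zero. -/
theorem continuousOn_observe {c δ M : ℝ} (hS : IsC0Semigroup S)
    (hA : IsInfinitesimalGenerator A S) (H : AnalyticBounds S A c δ M)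
    (hB : ObservationBoundedBy B b) (u₀ : A.domain) :
    ContinuousOn (observe S B u₀) (Ici 0) := by
  intro t ht
  rw [ContinuousWithinAt, tendsto_iff_norm_sub_tendsto_zero]
  have h1 : Tendsto (fun s => |b| * (‖S s (u₀ : X) - S t (u₀ : X)‖ + ‖S s (A u₀) - S t (A u₀)‖))
      (𝓝[Ici 0] t) (𝓝 0) := by
    have hu := tendsto_iff_norm_sub_tendsto_zero.1 (continuousOn_orbit hS H (u₀ : X) t ht)
    have hAu := tendsto_iff_norm_sub_tendsto_zero.1 (continuousOn_orbit hS H (A u₀) t ht)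
    simpa using (hu.add hAu).const_mul |b|
  refine squeeze_zero' (Eventually.of_forall fun _ => norm_nonneg _) ?_ h1
  filter_upwards [self_mem_nhdsWithin] with s hs
  rw [observe_eq hS hA _ hs, observe_eq hS hA _ ht, ← map_sub]
  refine (hB.norm_le _).trans_eq ?_
  rw [A.map_sub, LinearPMap.apply_eq_of_mem_graph (x := ⟨_, hS.map_mem_domain hA hs u₀⟩)
      (hS.map_mem_graph hA hs u₀),
    LinearPMap.apply_eq_of_mem_graph (x := ⟨_, hS.map_mem_domain hA ht u₀⟩)
      (hS.map_mem_graph hA ht u₀)]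
  rfl

/-- Interpolation error for the observation, in terms of the state at the earlier time `a`. -/
theorem norm_observe_sub_sum_le {c δ M : ℝ} (hS : IsC0Semigroup S)
    (hA : IsInfinitesimalGenerator A S) (H : AnalyticBounds S A c δ M) (hM : 0 ≤ M)
    (hc0 : 0 < c) (hc : c < 1)
    (hB : ObservationBoundedBy B b) (u₀ : A.domain) {a L : ℝ} (ha : 0 ≤ a) (hL : 0 < L)
    (hLδ : L / 2 < δ) {n : ℕ} {t w : ℕ → ℝ} {x ρ Λ : ℝ} (hρ0 : 0 ≤ ρ) (hρ : ρ ≤ 1 / 2)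
    (hx : |x - (a + L)| ≤ ρ * (c * (L / 2)))
    (ht : ∀ i ∈ Finset.range (n + 1), |t i - (a + L)| ≤ ρ * (c * (L / 2)))
    (hw : ∑ i ∈ Finset.range (n + 1), |w i| ≤ Λ)
    (hex : ∀ m ≤ n,
      ∑ i ∈ Finset.range (n + 1), w i * (t i - (a + L)) ^ m = (x - (a + L)) ^ m) :
    ‖observe S B u₀ x - ∑ i ∈ Finset.range (n + 1), ((w i : ℝ) : 𝕜) • observe S B u₀ (t i)‖
      ≤ |b| * (M + M / (L / 2)) * (2 * (1 + Λ) * (M * ‖S a u₀‖) * ρ ^ (n + 1)) := by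
  classical
  set D : ℝ → A.domain := fun s => if h : S s u₀ ∈ A.domain then ⟨S s u₀, h⟩ else 0 with hD
  have hDB : ∀ s, observe S B u₀ s = B (D s) := by
    intro s
    rw [observe, hD]
    split_ifs with h
    · simp [h]
    · simp [h]
  have hlarge : ∀ s, |s - (a + L)| ≤ ρ * (c * (L / 2)) → 0 ≤ s - a - L / 2 := by
    intro s hs
    have h6 : ρ * (c * (L / 2)) ≤ 1 / 2 * (1 * (L / 2)) := by gcongr
    have := (abs_le.1 hs).1
    linarith
  -- The orbit is split as `S (L / 2)`, which maps into `D(A)` at cost `M / (L / 2)`, times a middle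
  -- factor at times near `L / 2`, where interpolation takes place in `X`, times `S a`.
  have hDX : ∀ s, |s - (a + L)| ≤ ρ * (c * (L / 2)) →
      (D s : X) = S (L / 2) (S (s - a - L / 2) (S a u₀)) := by
    intro s hs
    have h0 := hlarge s hs
    have h1 : D s = ⟨S s u₀, hS.map_mem_domain hA (by linarith) u₀⟩ :=
      dif_pos (hS.map_mem_domain hA (by linarith) u₀)
    rw [h1]
    have h2 := hS.map_add (L / 2) ((s - a - L / 2) + a) (by positivity) (by positivity)
    rw [hS.map_add (s - a - L / 2) a h0 ha] at h2
    rw [show L / 2 + (s - a - L / 2 + a) = s by ring] at h2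
    exact DFunLike.congr_fun h2 (u₀ : X)
  set e : X := S (x - a - L / 2) (S a u₀) -
    ∑ i ∈ Finset.range (n + 1), ((w i : ℝ) : 𝕜) • S (t i - a - L / 2) (S a u₀) with he
  set z : A.domain := D x - ∑ i ∈ Finset.range (n + 1), ((w i : ℝ) : 𝕜) • D (t i) with hz
  have hzX : (z : X) = S (L / 2) e := by
    rw [hz, he, map_sub, map_sum]
    push_cast
    rw [hDX x hx]
    congr 1
    refine Finset.sum_congr rfl fun i hi => ?_
    rw [hDX _ (ht i hi), map_smul]
  have hzB : observe S B u₀ x - ∑ i ∈ Finset.range (n + 1),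
      ((w i : ℝ) : 𝕜) • observe S B u₀ (t i) = B z := by
    rw [hz, map_sub, map_sum]
    simp only [hDB, map_smul]
  have hsh : ∀ s : ℝ, s - a - L / 2 - L / 2 = s - (a + L) := fun s => by ring
  have he_le : ‖e‖ ≤ 2 * (1 + Λ) * (M * ‖S a u₀‖) * ρ ^ (n + 1) := by
    refine H.norm_interpolation_le (L / 2) (by positivity) hLδ (S a u₀) n
      (fun i => t i - a - L / 2) w (x - a - L / 2) ρ Λ hρ0 hρ ?_ ?_ hw ?_
    · rwa [hsh]
    · intro i hi
      rw [hsh]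
      exact ht i hi
    · intro m hm
      simp only [hsh]
      exact hex m hm
  have h1 : ‖(z : X)‖ ≤ M * ‖e‖ := by
    rw [hzX]
    exact H.norm_le _ (by positivity) hLδ e
  have h2 : ‖A z‖ ≤ M / (L / 2) * ‖e‖ := by
    refine H.norm_generator_le _ (by positivity) hLδ e (A z) ?_
    rw [← hzX]
    exact A.mem_graph z
  rw [hzB]
  calc ‖B z‖ ≤ |b| * (‖(z : X)‖ + ‖A z‖) := hB.norm_le z
    _ ≤ |b| * (M * ‖e‖ + M / (L / 2) * ‖e‖) := by gcongr
    _ = |b| * (M + M / (L / 2)) * ‖e‖ := by ring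
    _ ≤ _ := by gcongr

end Observation

/-! ### Propagation of smallness in time -/

/-- On a quarter of an interval, a nonnegative function is at most four times its mean. -/
theorem le_volume_inter_le_mean {E : Set ℝ} (hE : MeasurableSet E) {f : ℝ → ℝ} (hf0 : ∀ t, 0 ≤ f t)
    (hf : IntegrableOn f E) {l : ℝ} (hl : 0 < l) (hvol : ENNReal.ofReal (l / 2) ≤ volume E) :
    ENNReal.ofReal (l / 4) ≤ volume (E ∩ {t | f t ≤ 4 / l * ∫ t in E, f t}) := by
  set J := ∫ t in E, f t with hJ
  have hJ0 : 0 ≤ J := integral_nonneg hf0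
  set bad := E ∩ {t | 4 / l * J < f t} with hbad_def
  have hbad : volume bad ≤ ENNReal.ofReal (l / 4) := by
    -- Markov's inequality is empty at threshold zero; there the function vanishes almost everywhere
    -- on `E`.
    rcases hJ0.eq_or_lt with h0 | hpos
    · have h1 : f =ᵐ[volume.restrict E] 0 :=
        (integral_eq_zero_iff_of_nonneg hf0 hf).1 (hJ.symm.trans h0.symm)
      have h2 : volume bad = 0 := by
        have h3 : ∀ᵐ t, t ∈ E → f t = 0 := (ae_restrict_iff' hE).1 h1
        refine measure_mono_null ?_ (ae_iff.1 h3)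
        rintro t ⟨htE, ht⟩
        rw [← h0] at ht
        simp only [mul_zero, mem_ofPred_eq] at ht ⊢
        push Not
        exact ⟨htE, ht.ne'⟩
      rw [h2]
      exact zero_le
    · have h1 := mul_meas_ge_le_lintegral₀ hf.aestronglyMeasurable.aemeasurable.ennreal_ofReal
        (ENNReal.ofReal (4 / l * J))
      rw [← ofReal_integral_eq_lintegral_ofReal hf (Eventually.of_forall hf0), ← hJ] at h1
      have h2 : volume bad ≤ volume.restrict E
          {t | ENNReal.ofReal (4 / l * J) ≤ ENNReal.ofReal (f t)} := by
        rw [Measure.restrict_apply' hE]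
        refine measure_mono ?_
        rintro t ⟨htE, ht⟩
        exact ⟨ENNReal.ofReal_le_ofReal (le_of_lt ht), htE⟩
      have h3 : ENNReal.ofReal (4 / l * J) * volume bad ≤ ENNReal.ofReal J :=
        (mul_le_mul_right h2 _).trans h1
      have h4 : ENNReal.ofReal J = ENNReal.ofReal (4 / l * J) * ENNReal.ofReal (l / 4) := by
        rw [← ENNReal.ofReal_mul (by positivity)]
        congr 1
        field_simp
      rw [h4] at h3
      exact (ENNReal.mul_le_mul_iff_right (by
        rw [Ne, ENNReal.ofReal_eq_zero, not_le]; positivity) ENNReal.ofReal_ne_top).1 h3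
  have hsub : E ⊆ (E ∩ {t | f t ≤ 4 / l * J}) ∪ bad := by
    intro t ht
    rcases le_or_gt (f t) (4 / l * J) with h | h
    · exact Or.inl ⟨ht, h⟩
    · exact Or.inr ⟨ht, h⟩
  have h5 := (hvol.trans (measure_mono hsub)).trans (measure_union_le _ _)
  have h6 : ENNReal.ofReal (l / 2) = ENNReal.ofReal (l / 4) + ENNReal.ofReal (l / 4) := by
    rw [← ENNReal.ofReal_add (by positivity) (by positivity)]
    congr 1
    ring
  rw [h6] at h5
  exact (ENNReal.add_le_add_iff_right ENNReal.ofReal_ne_top).1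
    (h5.trans (add_le_add_right hbad _))

section Observation

variable {𝕜 : Type v} [RCLike 𝕜] {X : Type u} [NormedAddCommGroup X] [InnerProductSpace 𝕜 X]
  {U : Type w} [NormedAddCommGroup U] [InnerProductSpace 𝕜 U] {A : X →ₗ.[𝕜] X}
  {S : ℝ → X →L[𝕜] X} {B : A.domain →ₗ[𝕜] U} {b : ℝ}

/-- Propagation of smallness for the observation from a set of times that fills half of an
interval to the whole interval, with a free parameter `n`. -/
theorem norm_observe_le_of_half_interval {c δ M κ : ℝ} (hS : IsC0Semigroup S)
    (hA : IsInfinitesimalGenerator A S) (H : AnalyticBounds S A c δ M) (hM : 0 < M)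
    (hc0 : 0 < c) (hc : c < 1)
    (hκ : κ = 1 / (Real.exp 1 * (8 * Real.exp 1)) * (c / 2))
    (hB : ObservationBoundedBy B b) (u₀ : A.domain) {a L : ℝ} (ha : 0 ≤ a) (hL : 0 < L)
    (hL1 : L ≤ 1) (hLδ : L / 2 < δ) {E : Set ℝ} (hE : MeasurableSet E)
    (hEI : E ⊆ Icc (a + L - κ * L) (a + L))
    (hvol : ENNReal.ofReal (κ * L / 2) ≤ volume E) (n : ℕ) {x : ℝ}
    (hx : x ∈ Icc (a + L - κ * L) (a + L)) :
    ‖observe S B u₀ x‖ ≤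
      Real.exp 1 * (8 * Real.exp 1) ^ n * (4 / (κ * L) * ∫ t in E, ‖observe S B u₀ t‖) +
      12 * |b| * M ^ 2 / L * Real.exp (-n) * ‖S a u₀‖ := by
  have he1 : 1 ≤ Real.exp 1 := Real.one_le_exp zero_le_one
  set e := Real.exp 1 with he
  set K := 8 * e with hK
  set ρ := 1 / (e * K) with hρ
  have hK1 : 1 ≤ K := by rw [hK]; linarith
  have hρ0 : 0 < ρ := by positivity
  have hρ2 : ρ ≤ 1 / 2 := by
    rw [hρ]
    apply one_div_le_one_div_of_le (by norm_num)
    nlinarith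
  have hκ0 : 0 < κ := by rw [hκ]; positivity
  have hκL : κ * L = ρ * (c * (L / 2)) := by rw [hκ]; ring
  have hκ1 : κ * L ≤ L := by
    rw [hκL]
    have : ρ * (c * (L / 2)) ≤ 1 / 2 * (1 * (L / 2)) := by gcongr
    linarith
  have hnear : ∀ s ∈ Icc (a + L - κ * L) (a + L), |s - (a + L)| ≤ ρ * (c * (L / 2)) := by
    intro s hs
    rw [← hκL, abs_le]
    constructor <;> linarith [hs.1, hs.2]
  have hI : Icc (a + L - κ * L) (a + L) = Icc (a + L - κ * L) (a + L - κ * L + κ * L) := by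
    rw [sub_add_cancel]
  have hint : IntegrableOn (fun t => ‖observe S B u₀ t‖) E := by
    refine IntegrableOn.mono_set ?_ hEI
    refine ContinuousOn.integrableOn_compact isCompact_Icc ?_
    refine (continuousOn_observe hS hA H hB u₀).norm.mono fun s hs => ?_
    have := hs.1
    simp only [mem_Ici]
    linarith
  set J := ∫ t in E, ‖observe S B u₀ t‖ with hJ
  obtain ⟨t, w, htG, hw, hex⟩ := exists_interpolation_nodes (by positivity)
    (inter_subset_left.trans (hEI.trans hI.subset))
    (le_volume_inter_le_mean hE (fun t => norm_nonneg (observe S B u₀ t)) hint (by positivity) hvol)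
    (hI ▸ hx) n
  have h1 := norm_observe_sub_sum_le hS hA H hM.le hc0 hc hB u₀ ha hL hLδ hρ0.le hρ2 (hnear x hx)
    (fun i hi => hnear _ (hEI (htG i hi).1)) hw (fun m hm => hex (a + L) m hm)
  have h2 : ‖∑ i ∈ Finset.range (n + 1), ((w i : ℝ) : 𝕜) • observe S B u₀ (t i)‖
      ≤ e * K ^ n * (4 / (κ * L) * J) := by
    refine (norm_sum_le_of_le _ (f := fun i => ((w i : ℝ) : 𝕜) • observe S B u₀ (t i))
      (n := fun i => |w i| * (4 / (κ * L) * J)) fun i hi => ?_).trans ?_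
    · rw [norm_smul, RCLike.norm_ofReal]
      exact mul_le_mul_of_nonneg_left (htG i hi).2 (abs_nonneg _)
    · rw [← Finset.sum_mul]
      exact mul_le_mul_of_nonneg_right hw
        (mul_nonneg (by positivity) (integral_nonneg fun _ => norm_nonneg _))
  have h3 : |b| * (M + M / (L / 2)) * (2 * (1 + e * K ^ n) * (M * ‖S a u₀‖) * ρ ^ (n + 1))
      ≤ 12 * |b| * M ^ 2 / L * Real.exp (-n) * ‖S a u₀‖ := by
    -- The constant `12` is this `3`, times the `2` of the interpolation error, times the `2` of
    -- `h5`.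
    have h4 : M + M / (L / 2) ≤ 3 * M / L := by
      have : M ≤ M / L := le_div_self hM.le hL hL1
      calc M + M / (L / 2) ≤ M / L + M / (L / 2) := by gcongr
        _ = 3 * M / L := by field_simp; ring
    have h5 : (1 + e * K ^ n) * ρ ^ (n + 1) ≤ 2 * Real.exp (-n) := by
      have h6 : 1 ≤ e * K ^ n := one_le_mul_of_one_le_of_one_le he1 (one_le_pow₀ hK1)
      have h7 : Real.exp (-n) = (e ^ n)⁻¹ := by
        rw [Real.exp_neg, he, ← Real.exp_nat_mul, mul_one]
      calc (1 + e * K ^ n) * ρ ^ (n + 1) ≤ (2 * (e * K ^ n)) * ρ ^ (n + 1) := by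
            gcongr
            linarith
        _ = 2 * Real.exp (-n) / K := by
            have h8 : ∀ p q : ℝ, 0 < p → 0 < q →
                2 * (p * q ^ n) * (1 / (p * q)) ^ (n + 1) = 2 * (p ^ n)⁻¹ / q := by
              intro p q hp hq
              rw [one_div, inv_pow, pow_succ, mul_pow]
              field_simp
            rw [h7, hρ, h8 e K (by positivity) (by positivity)]
        _ ≤ 2 * Real.exp (-n) := div_le_self (by positivity) hK1
    calc _ = |b| * (M + M / (L / 2)) * (2 * (M * ‖S a u₀‖) * ((1 + e * K ^ n) * ρ ^ (n + 1))) := by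
          ring
      _ ≤ |b| * (3 * M / L) * (2 * (M * ‖S a u₀‖) * (2 * Real.exp (-n))) := by gcongr
      _ = _ := by ring
  calc ‖observe S B u₀ x‖ ≤ ‖∑ i ∈ Finset.range (n + 1), ((w i : ℝ) : 𝕜) • observe S B u₀ (t i)‖ +
        ‖observe S B u₀ x - ∑ i ∈ Finset.range (n + 1), ((w i : ℝ) : 𝕜) • observe S B u₀ (t i)‖ :=
        norm_le_norm_add_norm_sub' _ _
    _ ≤ _ := add_le_add h2 (h1.trans h3)

/-! ### The recursive estimate -/

/-- Observability at the end of an interval in terms of the supremum of the observation. -/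
theorem IntervalObservability.norm_le_exp_mul {d k : ℝ} (hS : IsC0Semigroup S)
    (hA : IsInfinitesimalGenerator A S) (hd : 0 < d) (hobs : IntervalObservability S B d k)
    (u₀ : A.domain) {a l F : ℝ} (ha : 0 ≤ a) (hl : 0 < l) (hl1 : l ≤ 1) (hF0 : 0 ≤ F)
    (hF : ∀ x ∈ Icc a (a + l), ‖observe S B u₀ x‖ ≤ F) :
    ‖S (a + l) u₀‖ ≤ Real.exp (d / l ^ k) * F := by
  have h1 := hobs l hl hl1 ⟨S a u₀, hS.map_mem_domain hA ha u₀⟩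
  have h2 : S l (S a (u₀ : X)) = S (a + l) u₀ := by
    rw [add_comm, hS.map_add l a hl.le ha]; rfl
  have h3 : ‖∫ t in (0 : ℝ)..l,
      ‖observe S B ⟨S a u₀, hS.map_mem_domain hA ha u₀⟩ t‖ ^ 2‖ ≤ F ^ 2 * |l - 0| := by
    refine intervalIntegral.norm_integral_le_of_norm_le_const fun t ht => ?_
    rw [uIoc_of_le hl.le] at ht
    rw [observe_add hS hA u₀ ha ht.1.le, Real.norm_eq_abs, abs_of_nonneg (by positivity)]
    have := hF (a + t) ⟨by linarith [ht.1], by linarith [ht.2]⟩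
    gcongr
  have h4 : ∫ t in (0 : ℝ)..l,
      ‖observe S B ⟨S a u₀, hS.map_mem_domain hA ha u₀⟩ t‖ ^ 2 ≤ F ^ 2 := by
    refine (le_abs_self _).trans (h3.trans ?_)
    rw [sub_zero, abs_of_pos hl]
    exact mul_le_of_le_one_right (by positivity) hl1
  -- As the exponential is at least one, it may be squared, so that taking square roots leaves no
  -- exponent `d / 2`.
  have h5 : 1 ≤ Real.exp (d / l ^ k) := Real.one_le_exp (by positivity)
  rw [h2] at h1
  refine (sq_le_sq₀ (norm_nonneg _) (by positivity)).1 (h1.trans ?_)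
  calc _ ≤ Real.exp (d / l ^ k) * F ^ 2 := by gcongr
    _ ≤ Real.exp (d / l ^ k) * (Real.exp (d / l ^ k) * F ^ 2) :=
        le_mul_of_one_le_left (by positivity) h5
    _ = _ := by ring

end Observation

/-- In the variable `u = 1 / L ^ k` this is `C u ^ (1 / k) ≤ exp u` for large `u`. It absorbs
prefactors of order `1 / L` into the exponentials. -/
theorem eventually_div_le_exp_one_div_rpow (C : ℝ) {k : ℝ} (hk : 0 < k) :
    ∀ᶠ L : ℝ in 𝓝[>] 0, C / L ≤ Real.exp (1 / L ^ k) := by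
  have h1 : Tendsto (fun L : ℝ => (L ^ k)⁻¹) (𝓝[>] 0) atTop := by
    have := (tendsto_rpow_atTop hk).comp tendsto_inv_nhdsGT_zero
    refine this.congr' ?_
    filter_upwards [self_mem_nhdsWithin] with L hL
    exact Real.inv_rpow (le_of_lt hL) k
  have h2 := (tendsto_exp_div_rpow_atTop (1 / k)).comp h1
  filter_upwards [h2.eventually_ge_atTop C, self_mem_nhdsWithin] with L hL hL0
  have hL0' : 0 < L := hL0
  have h3 : ((L ^ k)⁻¹) ^ (1 / k) = L⁻¹ := by
    rw [← Real.inv_rpow hL0'.le, ← Real.rpow_mul (by positivity), mul_one_div_cancel hk.ne',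
      Real.rpow_one]
  rw [Function.comp_apply, h3] at hL
  rw [div_le_iff₀ hL0', one_div]
  rwa [div_inv_eq_mul] at hL

/-- The recursive estimate: the state at the end of a short interval is controlled by the
observation, integrated over a set of times filling half of the last part of the interval, plus a
small multiple of the state at the beginning. -/
theorem IsC0Semigroup.exists_recursive_observability {𝕜 : Type v} [RCLike 𝕜] {X : Type u}
    [NormedAddCommGroup X] [InnerProductSpace 𝕜 X] {S : ℝ → X →L[𝕜] X} {A : X →ₗ.[𝕜] X}
    (hS : IsC0Semigroup S) (hA : IsInfinitesimalGenerator A S) {c δ M : ℝ}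
    (H : AnalyticBounds S A c δ M) (hM : 0 < M) (hc0 : 0 < c) (hc : c < 1) (hδ : 0 < δ)
    {d k : ℝ} (b : ℝ) (hd : 0 < d) (hk : 0 < k) :
    ∃ κ β L₀ : ℝ, 0 < κ ∧ κ ≤ 1 ∧ 0 < β ∧ 0 < L₀ ∧
      ∀ (U : Type w) [NormedAddCommGroup U] [InnerProductSpace 𝕜 U] (B : A.domain →ₗ[𝕜] U),
        ObservationBoundedBy B b → IntervalObservability S B d k →
        ∀ (u₀ : A.domain) (a L : ℝ) (E : Set ℝ), 0 ≤ a → 0 < L → L < L₀ → MeasurableSet E →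
          E ⊆ Icc (a + L - κ * L) (a + L) → ENNReal.ofReal (κ * L / 2) ≤ volume E →
          ‖S (a + L) u₀‖ ≤ Real.exp (β / L ^ k) * (∫ t in E, ‖observe S B u₀ t‖) +
            Real.exp (-(1 / L ^ k)) * ‖S a u₀‖ := by
  have he1 : 1 ≤ Real.exp 1 := Real.one_le_exp zero_le_one
  set e := Real.exp 1 with he
  set K := 8 * e with hK
  have hK1 : 1 ≤ K := by rw [hK]; linarith
  set κ := 1 / (e * K) * (c / 2) with hκ
  have hκ0 : 0 < κ := by positivity
  have hκ1 : κ ≤ 1 := by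
    have h1 : 1 / (e * K) ≤ 1 := by
      rw [div_le_one (by positivity)]
      exact one_le_mul_of_one_le_of_one_le he1 hK1
    calc κ ≤ 1 * (1 / 2) := by rw [hκ]; gcongr
      _ ≤ 1 := by norm_num
  set d' := d / κ ^ k with hd'
  have hd'0 : 0 < d' := by positivity
  have hlogK : 0 ≤ Real.log K := Real.log_nonneg hK1
  obtain ⟨L₀, hL₀, hsmall⟩ := (mem_nhdsGT_iff_exists_Ioo_subset).1
    ((eventually_div_le_exp_one_div_rpow (e * K * (4 / κ)) hk).and
      (eventually_div_le_exp_one_div_rpow (12 * |b| * M ^ 2) hk))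
  -- The three parts of `β` pay for observability on the window, for `K ^ n`, and for the prefactor
  -- of order `1 / L`.
  refine ⟨κ, d' + (d' + 2) * Real.log K + 1, min L₀ (min 1 δ), hκ0, hκ1, by positivity,
    lt_min hL₀ (lt_min one_pos hδ), ?_⟩
  intro U _ _ B hB hobs u₀ a L E ha hL hLL hE hEI hvol
  have hLL₀ : L < L₀ := hLL.trans_le (min_le_left _ _)
  have hL1 : L < 1 := hLL.trans_le ((min_le_right _ _).trans (min_le_left _ _))
  have hLδ : L < δ := hLL.trans_le ((min_le_right _ _).trans (min_le_right _ _))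
  obtain ⟨hs1, hs2⟩ := hsmall ⟨hL, hLL₀⟩
  set y := 1 / L ^ k with hy
  have hy0 : 0 < y := by positivity
  -- Of the decay `exp (-(d' + 2) y)`, the share `d'` cancels the observability cost, one unit
  -- absorbs the factor `1 / L`, and one unit remains as gain.
  set n := ⌈(d' + 2) * y⌉₊ with hn
  have hn1 : (d' + 2) * y ≤ n := Nat.le_ceil _
  have hn2 : (n : ℝ) ≤ (d' + 2) * y + 1 := (Nat.ceil_lt_add_one (by positivity)).le
  set J := ∫ t in E, ‖observe S B u₀ t‖ with hJ
  have hJ0 : 0 ≤ J := integral_nonneg fun _ => norm_nonneg _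
  set F := e * K ^ n * (4 / (κ * L) * J) + 12 * |b| * M ^ 2 / L * Real.exp (-n) * ‖S a u₀‖ with hF
  have hκL : κ * L ≤ L := mul_le_of_le_one_left hL.le hκ1
  have hsum : a + L - κ * L + κ * L = a + L := by ring
  have h1 := hobs.norm_le_exp_mul hS hA hd u₀ (a := a + L - κ * L) (l := κ * L) (F := F)
    (by linarith) (by positivity) (by linarith) (by positivity) (fun x hx =>
      norm_observe_le_of_half_interval hS hA H hM hc0 hc hκ hB u₀ ha hL hL1.le (by linarith) hE
        hEI hvol n (by rw [hsum] at hx; exact hx))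
  rw [hsum] at h1
  have h2 : d / (κ * L) ^ k = d' * y := by
    rw [Real.mul_rpow hκ0.le hL.le, hd', hy]
    field_simp
  rw [h2] at h1
  have hKn : K ^ n ≤ K * Real.exp ((d' + 2) * Real.log K * y) := by
    have hKe : K = Real.exp (Real.log K) := (Real.exp_log (by positivity)).symm
    calc K ^ n = Real.exp (n * Real.log K) := by
          rw [Real.exp_nat_mul, Real.exp_log (by positivity)]
      _ ≤ Real.exp (((d' + 2) * y + 1) * Real.log K) := by gcongr
      _ = K * Real.exp ((d' + 2) * Real.log K * y) := by
          rw [show ((d' + 2) * y + 1) * Real.log K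
            = Real.log K + (d' + 2) * Real.log K * y by ring, Real.exp_add,
            Real.exp_log (by positivity)]
  have hterm1 : Real.exp (d' * y) * (e * K ^ n * (4 / (κ * L) * J))
      ≤ Real.exp ((d' + (d' + 2) * Real.log K + 1) / L ^ k) * J := by
    calc _ ≤ Real.exp (d' * y) *
          (e * (K * Real.exp ((d' + 2) * Real.log K * y)) * (4 / (κ * L) * J)) := by gcongr
      _ = Real.exp (d' * y) * Real.exp ((d' + 2) * Real.log K * y) *
          (e * K * (4 / κ) / L) * J := by field_simp
      _ ≤ Real.exp (d' * y) * Real.exp ((d' + 2) * Real.log K * y) * Real.exp y * J := by gcongr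
      _ = _ := by
          rw [← Real.exp_add, ← Real.exp_add, hy]
          congr 2
          ring
  have hterm2 : Real.exp (d' * y) * (12 * |b| * M ^ 2 / L * Real.exp (-n) * ‖S a u₀‖)
      ≤ Real.exp (-y) * ‖S a u₀‖ := by
    calc _ ≤ Real.exp (d' * y) * (Real.exp y * Real.exp (-((d' + 2) * y)) * ‖S a u₀‖) := by gcongr
      _ = _ := by
          rw [← mul_assoc, ← mul_assoc, ← Real.exp_add, ← Real.exp_add]
          congr 2
          ring
  calc ‖S (a + L) u₀‖ ≤ _ := h1
    _ = Real.exp (d' * y) * (e * K ^ n * (4 / (κ * L) * J)) +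
        Real.exp (d' * y) * (12 * |b| * M ^ 2 / L * Real.exp (-n) * ‖S a u₀‖) := by
          rw [hF, mul_add]
    _ ≤ _ := add_le_add hterm1 hterm2

/-! ### Density point and telescoping sum -/

/-- Near almost every one of its points, a set fills half of every interval that lies to the right
of the point at a distance comparable to its length. -/
theorem exists_density_point {E : Set ℝ} (hE : MeasurableSet E) (hE0 : volume E ≠ 0) {η : ℝ}
    (hη0 : 0 < η) (hη1 : η ≤ 1) :
    ∃ p ∈ E, ∀ᶠ r : ℝ in 𝓝[>] 0,
      ENNReal.ofReal (η * r / 2) ≤ volume (E ∩ Icc (p + r - η * r) (p + r)) := by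
  have hne : (ae (volume.restrict E)).NeBot := by
    rw [ae_neBot, Ne, Measure.restrict_eq_zero]
    exact hE0
  obtain ⟨p, hpE, hp⟩ := ((ae_restrict_mem hE).and
    (IsUnifLocDoublingMeasure.ae_tendsto_measure_inter_div volume E (2 / η))).exists
  refine ⟨p, hpE, ?_⟩
  have hδ : Tendsto (fun r : ℝ => η * r / 2) (𝓝[>] 0) (𝓝[>] 0) := by
    refine tendsto_nhdsWithin_iff.2 ⟨?_, ?_⟩
    · have h1 : Continuous fun r : ℝ => η * r / 2 := by fun_prop
      have h2 := h1.tendsto 0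
      simp only [mul_zero, zero_div] at h2
      exact h2.mono_left nhdsWithin_le_nhds
    · filter_upwards [self_mem_nhdsWithin] with r hr
      have : 0 < r := hr
      simp only [mem_Ioi]
      positivity
  -- The window need not contain `p`, so the density theorem is used for off-centre balls: dilated
  -- by `2 / η`, the ball has radius `r` and contains `p`.
  have hlim := hp (fun r => p + r - η * r / 2) (fun r => η * r / 2) hδ (by
    filter_upwards [self_mem_nhdsWithin] with r hr
    have hr' : 0 < r := hr
    have h3 : 2 / η * (η * r / 2) = r := by field_simp
    rw [h3, Metric.mem_closedBall, Real.dist_eq, abs_le]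
    constructor <;> nlinarith)
  have h4 := hlim.eventually (eventually_gt_nhds (show ENNReal.ofReal (1 / 2) < 1 by
    rw [ENNReal.ofReal_lt_one]; norm_num))
  filter_upwards [h4, self_mem_nhdsWithin] with r hr hr0
  have hr0' : 0 < r := hr0
  rw [Real.closedBall_eq_Icc, show p + r - η * r / 2 - η * r / 2 = p + r - η * r by ring,
    show p + r - η * r / 2 + η * r / 2 = p + r by ring, Real.volume_Icc,
    show p + r - (p + r - η * r) = η * r by ring] at hr
  have h5 := ENNReal.mul_le_of_le_div hr.le
  rwa [← ENNReal.ofReal_mul (by norm_num), show 1 / 2 * (η * r) = η * r / 2 by ring] at h5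

theorem theorem1p1 {𝕜 : Type v} [RCLike 𝕜]
    {X : Type u} [NormedAddCommGroup X] [InnerProductSpace 𝕜 X] [CompleteSpace X]
    (S : ℝ → X →L[𝕜] X) (A : X →ₗ.[𝕜] X)
    (hS : IsC0Semigroup S) (hA : IsInfinitesimalGenerator A S) (hSa : IsAnalyticSemigroup S)
    (T : ℝ) (hT : 0 < T) (E : Set ℝ) (hE : NullMeasurableSet E volume)
    (hET : E ⊆ Ioo 0 T) (hE0 : 0 < volume E)
    (d k b : ℝ) (hd : 0 < d) (hk : 0 < k) :
    ∃ C : ℝ, 0 < C ∧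
      ∀ (U : Type w) [NormedAddCommGroup U] [InnerProductSpace 𝕜 U] [CompleteSpace U]
        (B : A.domain →ₗ[𝕜] U),
        ObservationBoundedBy B b →
        IsAdmissibleObservation S B →
        IntervalObservability S B d k →
        ∀ u₀ : A.domain, ‖S T u₀‖ ≤ C * ∫ t in E, ‖observe S B u₀ t‖ := by
  obtain ⟨c, δ, M, hc0, hc, hδ, hM, H⟩ := hS.exists_analyticBounds hA hSa
  obtain ⟨κ, β, L₀, hκ0, hκ1, hβ, hL₀, hrec⟩ :=
    hS.exists_recursive_observability.{u, v, w} hA H hM hc0 hc hδ b hd hk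
  obtain ⟨E', hE'E, hE'm, hE'ae⟩ := hE.exists_measurable_subset_ae_eq
  -- This ratio gives `β y (m + 1) = (β + 1) y m` below, the identity that makes the sum telescope.
  obtain ⟨q, hq0, hq1, hqk⟩ : ∃ q : ℝ, 0 < q ∧ q < 1 ∧ q ^ k = β / (β + 1) := by
    have hp : β / (β + 1) < 1 := by rw [div_lt_one (by positivity)]; linarith
    refine ⟨(β / (β + 1)) ^ (1 / k), by positivity,
      Real.rpow_lt_one (by positivity) hp (by positivity), ?_⟩
    rw [← Real.rpow_mul (by positivity), one_div_mul_cancel hk.ne', Real.rpow_one]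
  have hq1' : 0 < 1 - q := by linarith
  -- The interval from `p + s (m + 1)` to `p + s m` has length `(1 - q) s m`, so its final
  -- `κ`-fraction has length `η s m`.
  obtain ⟨p, hpE, hp⟩ := exists_density_point hE'm (by rw [measure_congr hE'ae]; exact hE0.ne')
    (η := κ * (1 - q)) (by positivity) (by nlinarith)
  have hp0T : p ∈ Ioo 0 T := hET (hE'E hpE)
  obtain ⟨r₀, hr₀, hdens⟩ := (mem_nhdsGT_iff_exists_Ioo_subset).1 hp
  have hr₀' : 0 < r₀ := hr₀
  -- The four bounds serve the density estimate, the recursion, the bound on `S (s m)`, and `p + r <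
  -- T`.
  obtain ⟨r, hr0, hr⟩ : ∃ r : ℝ, 0 < r ∧ r < min (min r₀ L₀) (min δ (T - p)) :=
    exists_between (lt_min (lt_min hr₀' hL₀) (lt_min hδ (by linarith [hp0T.2])))
  simp only [lt_min_iff] at hr
  obtain ⟨⟨hrr₀, hrL₀⟩, hrδ, hrT⟩ := hr
  set s : ℕ → ℝ := fun m => r * q ^ m with hs
  have hs0 : ∀ m, 0 < s m := fun m => by positivity
  have hsr : ∀ m, s m ≤ r := fun m =>
    mul_le_of_le_one_right hr0.le (pow_le_one₀ hq0.le hq1.le)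
  have hs_succ : ∀ m, s (m + 1) = s m * q := fun m => by simp only [hs, pow_succ]; ring
  set y : ℕ → ℝ := fun m => 1 / (s m * (1 - q)) ^ k with hy
  have hy0 : ∀ m, 0 < y m := fun m => by
    have := hs0 m
    positivity
  have hy_succ : ∀ m, β * y (m + 1) = (β + 1) * y m := by
    intro m
    have := hs0 m
    simp only [hy]
    rw [hs_succ, mul_right_comm, Real.mul_rpow (by positivity) hq0.le, hqk]
    field_simp
  have hexp_lim : Tendsto (fun m => Real.exp (-(β * y m))) atTop (𝓝 0) := by
    have hgeo : ∀ m, y m = y 0 * ((β + 1) / β) ^ m := by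
      intro m
      induction m with
      | zero => simp
      | succ m ih =>
        have := hy_succ m
        rw [pow_succ, ← mul_assoc, ← ih]
        field_simp
        linarith
    have h1 : 1 < (β + 1) / β := by rw [one_lt_div hβ]; linarith
    have h2 : Tendsto (fun m => β * y m) atTop atTop := by
      exact (((tendsto_pow_atTop_atTop_of_one_lt h1).const_mul_atTop (hy0 0)).const_mul_atTop
        hβ).congr fun m => by rw [← hgeo m]
    exact Real.tendsto_exp_neg_atTop_nhds_zero.comp h2
  refine ⟨(‖S (T - (p + r))‖ + 1) * Real.exp (β * y 0), by positivity, ?_⟩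
  intro U _ _ _ B hB _ hobs u₀
  set f : ℝ → ℝ := fun t => ‖observe S B u₀ t‖ with hf
  set g : ℝ → ℝ := E'.indicator f with hg
  have hf0 : ∀ t, 0 ≤ f t := fun t => norm_nonneg _
  have hg0 : ∀ t, 0 ≤ g t := fun t => indicator_nonneg (fun t _ => hf0 t) t
  have hgint : Integrable g := by
    refine (integrable_indicator_iff hE'm).2 (IntegrableOn.mono_set (t := Icc 0 T) ?_
      ((hE'E.trans hET).trans Ioo_subset_Icc_self))
    exact ContinuousOn.integrableOn_compact isCompact_Icc
      ((continuousOn_observe hS hA H hB u₀).norm.mono Icc_subset_Ici_self)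
  have hgE : ∫ t, g t = ∫ t in E, f t := by
    rw [hg, integral_indicator hE'm, setIntegral_congr_set hE'ae]
  -- The recursion multiplied by `exp (-(β y m))`: the integral gets coefficient one, and the state
  -- gets `exp (-((β + 1) y m))`, which is the next weight.
  have hstep : ∀ m, Real.exp (-(β * y m)) * ‖S (p + s m) u₀‖ ≤
      (∫ t in (p + s (m + 1))..(p + s m), g t) +
        Real.exp (-(β * y (m + 1))) * ‖S (p + s (m + 1)) u₀‖ := by
    intro m
    have hsm := hs0 m
    have hend : p + s (m + 1) + s m * (1 - q) = p + s m := by rw [hs_succ]; ring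
    have hle : κ * (s m * (1 - q)) ≤ s m * (1 - q) :=
      mul_le_of_le_one_left (by positivity) hκ1
    have h1 := hrec U B hB hobs u₀ (p + s (m + 1)) (s m * (1 - q))
      (E' ∩ Icc (p + s m - κ * (s m * (1 - q))) (p + s m))
      (by linarith [hp0T.1, hs0 (m + 1)]) (by positivity)
      (by nlinarith [hsr m]) (hE'm.inter measurableSet_Icc)
      (by rw [hend]; exact inter_subset_right) (by
        have := hdens (show s m ∈ Ioo 0 r₀ from ⟨hsm, (hsr m).trans_lt hrr₀⟩)
        simp only [mem_ofPred_eq] at this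
        rwa [show κ * (1 - q) * s m = κ * (s m * (1 - q)) by ring] at this)
    rw [hend] at h1
    have h2 : ∫ t in E' ∩ Icc (p + s m - κ * (s m * (1 - q))) (p + s m), f t
        ≤ ∫ t in (p + s (m + 1))..(p + s m), g t := by
      rw [inter_comm, ← setIntegral_indicator hE'm,
        intervalIntegral.integral_of_le (by rw [← hend]; linarith [mul_pos hsm hq1']),
        ← integral_Icc_eq_integral_Ioc]
      refine setIntegral_mono_set hgint.integrableOn (Eventually.of_forall hg0) ?_
      exact (Icc_subset_Icc_left (by linarith)).eventuallyLE
    have h3 : ‖S (p + s m) u₀‖ ≤ Real.exp (β * y m) *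
        (∫ t in (p + s (m + 1))..(p + s m), g t) +
        Real.exp (-(y m)) * ‖S (p + s (m + 1)) u₀‖ := by
      refine h1.trans (add_le_add ?_ le_rfl)
      rw [show β / (s m * (1 - q)) ^ k = β * y m by simp only [hy]; ring]
      exact mul_le_mul_of_nonneg_left h2 (Real.exp_nonneg _)
    calc Real.exp (-(β * y m)) * ‖S (p + s m) u₀‖
        ≤ Real.exp (-(β * y m)) * (Real.exp (β * y m) *
          (∫ t in (p + s (m + 1))..(p + s m), g t) +
          Real.exp (-(y m)) * ‖S (p + s (m + 1)) u₀‖) := by gcongr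
      _ = _ := by
        rw [mul_add, ← mul_assoc, ← mul_assoc, ← Real.exp_add, ← Real.exp_add, neg_add_cancel,
          Real.exp_zero, one_mul, hy_succ]
        congr 3
        ring
  have htele : ∀ m, Real.exp (-(β * y 0)) * ‖S (p + s 0) u₀‖ ≤
      (∫ t in (p + s m)..(p + s 0), g t) + Real.exp (-(β * y m)) * ‖S (p + s m) u₀‖ := by
    intro m
    induction m with
    | zero => simp
    | succ m ih =>
      rw [← intervalIntegral.integral_add_adjacent_intervals (b := p + s m)
        hgint.intervalIntegrable hgint.intervalIntegrable]
      linarith [hstep m]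
  -- The intervals are disjoint, so the integrals add up to at most the integral over `E`; the last
  -- state is `S (s m) (S p u₀)`, bounded uniformly in `m`.
  have hbound : ∀ m, Real.exp (-(β * y 0)) * ‖S (p + s 0) u₀‖ ≤
      (∫ t in E, f t) + Real.exp (-(β * y m)) * (M * ‖S p u₀‖) := by
    intro m
    refine (htele m).trans (add_le_add ?_ ?_)
    · have hle : s m ≤ s 0 := by
        have h4 : s 0 = r := by simp [hs]
        rw [h4]
        exact hsr m
      rw [intervalIntegral.integral_of_le (by linarith), ← hgE]
      exact setIntegral_le_integral hgint (Eventually.of_forall hg0)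
    · refine mul_le_mul_of_nonneg_left ?_ (Real.exp_nonneg _)
      rw [add_comm, hS.map_add _ _ (hs0 m).le hp0T.1.le]
      exact H.norm_le _ (hs0 m) ((hsr m).trans_lt hrδ) _
  have hlimit : Real.exp (-(β * y 0)) * ‖S (p + s 0) u₀‖ ≤ ∫ t in E, f t := by
    have h6 := (hexp_lim.mul_const (M * ‖S p (u₀ : X)‖)).const_add (∫ t in E, f t)
    rw [zero_mul, add_zero] at h6
    exact ge_of_tendsto' h6 hbound
  have hs0r : s 0 = r := by simp [hs]
  have hfirst : ‖S (p + r) u₀‖ ≤ Real.exp (β * y 0) * ∫ t in E, f t := by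
    rw [hs0r] at hlimit
    rwa [Real.exp_neg, inv_mul_le_iff₀ (Real.exp_pos _)] at hlimit
  have hlast : S T u₀ = S (T - (p + r)) (S (p + r) u₀) := by
    have h5 := hS.map_add (T - (p + r)) (p + r) (by linarith) (by linarith [hp0T.1])
    rw [sub_add_cancel] at h5
    rw [h5]
    rfl
  rw [hlast, mul_assoc]
  calc ‖S (T - (p + r)) (S (p + r) u₀)‖ ≤ ‖S (T - (p + r))‖ * ‖S (p + r) u₀‖ :=
        (S (T - (p + r))).le_opNorm _
    _ ≤ (‖S (T - (p + r))‖ + 1) * (Real.exp (β * y 0) * ∫ t in E, f t) := by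
        gcongr
        linarith
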